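/- Let $d\in\mathbb{N}$, let $\alpha\in(0,1)$ and let $\sigma_\alpha(x)=\max(\alpha x,x)$ be the leaky-ReLU function, acting coordinatewise on $\mathbb{R}^d$. A leaky-ReLU network of width $d$ and depth $L\ge 0$ is a map $f_L:\mathbb{R}^d\to\mathbb{R}^d$ given by $f_0(x)=W_0x+b_0$ and $f_k(x)=W_k\,\sigma_\alpha(f_{k-1}(x))+b_k$ for $1\le k\le L$, with $W_k\in\mathbb{R}^{d\times d}$ and $b_k\in\mathbb{R}^d$. Let $\tau>0$ and let $v(x,t)\in\mathbb{R}^d$ ($x\in\mathbb{R}^d$, $t\in(0,\tau)$) be a field that is Lipschitz in $x$ with a constant independent of $t$ and piecewise regular in $t$: there are finitely many break times such that $v$ is jointly continuous in $(x,t)$ on each of the open time pieces between them (no differentiability in $t$ is needed, so in particular $v$ may be piecewise smooth in $t$; the values of $v$ at the break times play no role). Let $\varphi^\tau:\mathbb{R}^d\to\mathbb{R}^d$, $x_0\mapsto x(\tau)$, be the flow map of $\dot x(t)=v(x(t),t)$, $x(0)=x_0$, where a solution is a continuous curve on $[0,\tau]$ that satisfies the equation at all but finitely many times. Let $\Omega\subset\mathbb{R}^d$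 be compact. Then for every $\varepsilon>0$ there are a depth $L$ and a leaky-ReLU network $f_L$ of width $d$ and depth $L$ such that $\|f_L(x)-\varphi^\tau(x)\|\le\varepsilon$ for all $x\in\Omega$, where $\|\cdot\|$ is the Euclidean norm. -/

import Mathlib

/-- The leaky-ReLU activation `σ_α(x) = max(αx, x)`. -/
def leakyReLU (α x : ℝ) : ℝ := max (α * x) x

/-- The activation acting coordinatewise on `ℝ^d`. -/
def leakyReLUVec {d : ℕ} (α : ℝ) (x : EuclideanSpace ℝ (Fin d)) : EuclideanSpace ℝ (Fin d) :=
  WithLp.toLp 2 (fun i => leakyReLU α (x i))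

/-- The affine map `x ↦ W x + b` on `ℝ^d`. -/
def affineLayer {d : ℕ} (W : Matrix (Fin d) (Fin d) ℝ) (b x : EuclideanSpace ℝ (Fin d)) :
    EuclideanSpace ℝ (Fin d) :=
  WithLp.toLp 2 (W.mulVec x.ofLp) + b

/-- The feedforward network whose layers all have width `d`:
`f_0(x) = W_0 x + b_0` and `f_{k+1}(x) = W_{k+1} σ_α(f_k(x)) + b_{k+1}`.
Only the parameters with index at most `k` enter `f_k`. -/
def leakyReLUNet {d : ℕ} (α : ℝ) (W : ℕ → Matrix (Fin d) (Fin d) ℝ)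
    (b : ℕ → EuclideanSpace ℝ (Fin d)) :
    ℕ → EuclideanSpace ℝ (Fin d) → EuclideanSpace ℝ (Fin d)
  | 0, x => affineLayer (W 0) (b 0) x
  | k + 1, x => affineLayer (W (k + 1)) (b (k + 1)) (leakyReLUVec α (leakyReLUNet α W b k x))

/-- `𝒩_d(L)`: the maps realised by leaky-ReLU networks of width `d` and depth `L`. -/
def LeakyReLUNetworks (α : ℝ) (d L : ℕ) :
    Set (EuclideanSpace ℝ (Fin d) → EuclideanSpace ℝ (Fin d)) :=
  {f | ∃ (W : ℕ → Matrix (Fin d) (Fin d) ℝ) (b : ℕ → EuclideanSpace ℝ (Fin d)),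
    f = leakyReLUNet α W b L}

/-- The standing assumption on the time-dependent field `v(x,t)`, `x ∈ ℝ^d`, `t ∈ (0,τ)`:
it is Lipschitz in `x` (uniformly in `t`), and there are finitely many break times such that on
each of the open time pieces between them `v` is jointly continuous in `(x,t)`. (The pieces are
the components of the open set `(0,τ) \ S`, so continuity on each piece is continuity on the union.)
Nothing is asked at the break times, and no differentiability in `t` is asked on the
pieces, so every field that is piecewise `C^1` or piecewise `C^∞` in `t` is included. -/
def IsLipschitzPiecewiseField {d : ℕ} (τ : ℝ)
    (v : EuclideanSpace ℝ (Fin d) → ℝ → EuclideanSpace ℝ (Fin d)) : Prop :=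
  ∃ S : Finset ℝ,
    (∃ K : NNReal, ∀ t ∈ Set.Ioo (0 : ℝ) τ \ (S : Set ℝ), LipschitzWith K (fun x => v x t)) ∧
    ContinuousOn (fun p : EuclideanSpace ℝ (Fin d) × ℝ => v p.1 p.2)
      (Set.univ ×ˢ (Set.Ioo (0 : ℝ) τ \ (S : Set ℝ)))

/-- `γ` solves `γ'(t) = v(γ(t),t)` on `(0,τ)`, `γ(0) = x₀`: it is continuous on `[0,τ]` and
satisfies the equation at all but finitely many times (`v` may jump at its break times, where
a solution has a corner). -/
def IsSolution {d : ℕ} (v : EuclideanSpace ℝ (Fin d) → ℝ → EuclideanSpace ℝ (Fin d))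
    (τ : ℝ) (x₀ : EuclideanSpace ℝ (Fin d)) (γ : ℝ → EuclideanSpace ℝ (Fin d)) : Prop :=
  ContinuousOn γ (Set.Icc 0 τ) ∧ γ 0 = x₀ ∧
    ∃ S : Finset ℝ, ∀ t ∈ Set.Ioo (0 : ℝ) τ, t ∉ S → HasDerivAt γ (v (γ t) t) t

/-- `φ` is the time-`τ` flow map `x₀ ↦ x(τ)` of `x' = v(x,t)`. (For a field that is Lipschitz in
`x` the solution from each `x₀`, hence `φ`, is unique.) -/
def IsFlowMap {d : ℕ} (v : EuclideanSpace ℝ (Fin d) → ℝ → EuclideanSpace ℝ (Fin d))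
    (τ : ℝ) (φ : EuclideanSpace ℝ (Fin d) → EuclideanSpace ℝ (Fin d)) : Prop :=
  ∀ x₀, ∃ γ : ℝ → EuclideanSpace ℝ (Fin d), IsSolution v τ x₀ γ ∧ γ τ = φ x₀

/-! ### Networks of fixed width: closure under composition and locally uniform limits. -/

section NetworkClosure

variable {d : ℕ} {α : ℝ}

local notation "𝔼" => EuclideanSpace ℝ (Fin d)

/-! The flow is a composition of short steps `z ↦ z + h U(z)`, and networks compose, so it is enough
to approximate each step with error `o(h)`. Call such a `U` a tangent field. Tangent fields are
closed under sums of continuous fields (compose the steps) and under locally uniform limits. One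
activation bends a single coordinate, and zigzags give every function of that coordinate with slopes
in `[α, 1]`. Conjugating by shears yields the ridge fields `g(ℓ z) e_j`, in particular `exp(w z)
e_j` with `w e_j > 0`. With the constants these span a point-separating algebra, so
Stone–Weierstrass makes every continuous field tangent (`tangentField_of_continuous`). The Euler
steps use different fields, so `h` must be chosen uniformly; Arzelà–Ascoli provides this for
`K`-Lipschitz fields vanishing at `0` (`exists_uniform_step`). Subtracting a reference trajectory
makes the field vanish at `0`, and `exists_netApprox_solution_map` sums the errors. -/

/-- `f` is realised by a leaky-ReLU network of width `d` and some depth. -/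
def IsNet (α : ℝ) (f : 𝔼 → 𝔼) : Prop := ∃ L, f ∈ LeakyReLUNetworks α d L

theorem affineLayer_affineLayer (W W' : Matrix (Fin d) (Fin d) ℝ) (b b' x : 𝔼) :
    affineLayer W b (affineLayer W' b' x) = affineLayer (W * W') (affineLayer W b b') x := by
  ext i
  simp [affineLayer, Matrix.mulVec_add, add_assoc]

theorem exists_affineLayer_eq (A : 𝔼 →ₗ[ℝ] 𝔼) (b : 𝔼) :
    ∃ W, ∀ x, affineLayer W b x = A x + b := by
  refine ⟨Matrix.toEuclideanLin.symm A, fun x => ?_⟩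
  have h : Matrix.toEuclideanLin (Matrix.toEuclideanLin.symm A) x = A x := by simp
  rw [← h]
  rfl

theorem leakyReLUNet_congr {W W' : ℕ → Matrix (Fin d) (Fin d) ℝ} {b b' : ℕ → 𝔼} (L : ℕ)
    (hW : ∀ k ≤ L, W k = W' k) (hb : ∀ k ≤ L, b k = b' k) :
    leakyReLUNet α W b L = leakyReLUNet α W' b' L := by
  induction L with
  | zero => funext x; simp [leakyReLUNet, hW 0 le_rfl, hb 0 le_rfl]
  | succ n ih =>
    have := ih (fun k hk => hW k (by omega)) (fun k hk => hb k (by omega))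
    funext x
    simp [leakyReLUNet, hW (n + 1) le_rfl, hb (n + 1) le_rfl, this]

theorem isNet_affineLayer (W : Matrix (Fin d) (Fin d) ℝ) (b : 𝔼) :
    IsNet α (affineLayer W b) :=
  ⟨0, fun _ => W, fun _ => b, by funext x; rfl⟩

theorem isNet_affine (A : 𝔼 →ₗ[ℝ] 𝔼) (b : 𝔼) : IsNet α (fun x => A x + b) := by
  obtain ⟨W, hW⟩ := exists_affineLayer_eq A b
  have : (fun x => A x + b) = affineLayer W b := by funext x; rw [hW]
  rw [this]
  exact isNet_affineLayer W b

theorem IsNet.layer {f : 𝔼 → 𝔼} (hf : IsNet α f) (W : Matrix (Fin d) (Fin d) ℝ) (b : 𝔼) :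
    IsNet α (fun x => affineLayer W b (leakyReLUVec α (f x))) := by
  obtain ⟨L, W', b', rfl⟩ := hf
  refine ⟨L + 1, fun k => if k ≤ L then W' k else W, fun k => if k ≤ L then b' k else b, ?_⟩
  funext x
  have := leakyReLUNet_congr (α := α) (W := W') (b := b')
    (W' := fun k => if k ≤ L then W' k else W) (b' := fun k => if k ≤ L then b' k else b) L
    (fun k hk => by simp [hk]) (fun k hk => by simp [hk])
  rw [this]
  simp [leakyReLUNet]

theorem IsNet.affineLayer_comp {f : 𝔼 → 𝔼} (hf : IsNet α f) (W : Matrix (Fin d) (Fin d) ℝ)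
    (b : 𝔼) : IsNet α (fun x => affineLayer W b (f x)) := by
  obtain ⟨L, W', b', rfl⟩ := hf
  cases L with
  | zero =>
    simp only [leakyReLUNet, affineLayer_affineLayer]
    exact isNet_affineLayer _ _
  | succ n =>
    simp only [leakyReLUNet, affineLayer_affineLayer]
    exact IsNet.layer ⟨n, W', b', rfl⟩ _ _

theorem IsNet.comp {g f : 𝔼 → 𝔼} (hg : IsNet α g) (hf : IsNet α f) :
    IsNet α (fun x => g (f x)) := by
  obtain ⟨L, W, b, rfl⟩ := hg
  induction L with
  | zero => exact hf.affineLayer_comp _ _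
  | succ n ih => exact ih.layer _ _

theorem isNet_leakyReLUVec : IsNet α (leakyReLUVec α : 𝔼 → 𝔼) := by
  have h := ((isNet_affine (α := α) (LinearMap.id : 𝔼 →ₗ[ℝ] 𝔼) 0)).layer 1 0
  convert h using 2 with x
  ext i
  simp [affineLayer]

theorem continuous_affineLayer (W : Matrix (Fin d) (Fin d) ℝ) (b : 𝔼) :
    Continuous (affineLayer W b) := by
  have h : affineLayer W b = fun x => Matrix.toEuclideanLin W x + b := rfl
  rw [h]
  exact (LinearMap.continuous_of_finiteDimensional _).add continuous_const

theorem continuous_leakyReLUVec : Continuous (leakyReLUVec α : 𝔼 → 𝔼) := by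
  unfold leakyReLUVec leakyReLU
  fun_prop

theorem IsNet.continuous {f : 𝔼 → 𝔼} (hf : IsNet α f) : Continuous f := by
  obtain ⟨L, W, b, rfl⟩ := hf
  induction L with
  | zero => exact continuous_affineLayer _ _
  | succ n ih => exact (continuous_affineLayer _ _).comp (continuous_leakyReLUVec.comp ih)

theorem exists_norm_le_of_continuous {F : 𝔼 → 𝔼} (hF : Continuous F) (R : ℝ) :
    ∃ M, 0 ≤ M ∧ ∀ x, ‖x‖ ≤ R → ‖F x‖ ≤ M := by
  obtain ⟨M, hM⟩ := (isCompact_closedBall (0 : 𝔼) R).exists_bound_of_continuousOn hF.continuousOn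
  exact ⟨max M 0, le_max_right _ _, fun x hx => (hM x (by simpa using hx)).trans (le_max_left _ _)⟩

theorem exists_modulus_of_continuous {F : 𝔼 → 𝔼} (hF : Continuous F) (R : ℝ) {ε : ℝ}
    (hε : 0 < ε) : ∃ δ, 0 < δ ∧ ∀ x y, ‖x‖ ≤ R → ‖y‖ ≤ R → ‖x - y‖ < δ → ‖F x - F y‖ < ε := by
  have h := (isCompact_closedBall (0 : 𝔼) R).uniformContinuousOn_of_continuous hF.continuousOn
  obtain ⟨δ, hδ, h⟩ := Metric.uniformContinuousOn_iff.1 h ε hε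
  refine ⟨δ, hδ, fun x y hx hy hxy => ?_⟩
  have := h x (by simpa using hx) y (by simpa using hy) (by rwa [dist_eq_norm])
  rwa [dist_eq_norm] at this

/-- The continuous maps that networks approximate uniformly on every ball. -/
def NetApprox (α : ℝ) (F : 𝔼 → 𝔼) : Prop :=
  Continuous F ∧ ∀ R ε : ℝ, 0 < ε → ∃ f, IsNet α f ∧ ∀ x, ‖x‖ ≤ R → ‖f x - F x‖ ≤ ε

theorem IsNet.netApprox {f : 𝔼 → 𝔼} (hf : IsNet α f) : NetApprox α f :=
  ⟨hf.continuous, fun R ε hε => ⟨f, hf, fun x _ => by simpa using hε.le⟩⟩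

theorem netApprox_id : NetApprox α (fun x : 𝔼 => x) := by
  simpa using (isNet_affine (α := α) (LinearMap.id : 𝔼 →ₗ[ℝ] 𝔼) 0).netApprox

theorem netApprox_of_limit {F : 𝔼 → 𝔼} (hF : Continuous F)
    (h : ∀ R ε : ℝ, 0 < ε → ∃ G, NetApprox α G ∧ ∀ x, ‖x‖ ≤ R → ‖G x - F x‖ ≤ ε) :
    NetApprox α F := by
  refine ⟨hF, fun R ε hε => ?_⟩
  obtain ⟨G, hG, hGF⟩ := h R (ε / 2) (by positivity)
  obtain ⟨f, hf, hfG⟩ := hG.2 R (ε / 2) (by positivity)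
  refine ⟨f, hf, fun x hx => ?_⟩
  calc ‖f x - F x‖ = ‖(f x - G x) + (G x - F x)‖ := by congr 1; abel
    _ ≤ ‖f x - G x‖ + ‖G x - F x‖ := norm_add_le _ _
    _ ≤ ε := by linarith [hfG x hx, hGF x hx]

theorem NetApprox.comp {F G : 𝔼 → 𝔼} (hF : NetApprox α F) (hG : NetApprox α G) :
    NetApprox α (fun x => F (G x)) := by
  refine ⟨hF.1.comp hG.1, fun R ε hε => ?_⟩
  obtain ⟨M, -, hM⟩ := exists_norm_le_of_continuous hG.1 R
  obtain ⟨δ, hδ, hFδ⟩ := exists_modulus_of_continuous hF.1 (M + 1) (half_pos hε)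
  obtain ⟨f, hf, hfF⟩ := hF.2 (M + 1) (ε / 2) (half_pos hε)
  obtain ⟨g, hg, hgG⟩ := hG.2 R (min (δ / 2) 1) (by positivity)
  refine ⟨_, hf.comp hg, fun x hx => ?_⟩
  have h1 := hgG x hx
  have hd : ‖g x - G x‖ < δ := by linarith [min_le_left (δ / 2) 1]
  have hgM : ‖g x‖ ≤ M + 1 := by
    have := norm_le_norm_add_norm_sub' (g x) (G x)
    linarith [min_le_right (δ / 2) 1, hM x hx]
  calc ‖f (g x) - F (G x)‖ = ‖(f (g x) - F (g x)) + (F (g x) - F (G x))‖ := by congr 1; abel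
    _ ≤ ‖f (g x) - F (g x)‖ + ‖F (g x) - F (G x)‖ := norm_add_le _ _
    _ ≤ ε := by
      linarith [hfF _ hgM, hFδ (g x) (G x) hgM (by linarith [hM x hx]) hd]

end NetworkClosure

/-! ### Monotone maps of one coordinate, and ridge maps. -/

section CoordinateMaps

variable {d : ℕ} {α : ℝ}

local notation "𝔼" => EuclideanSpace ℝ (Fin d)

/-- The map applying `H` to the `j`-th coordinate and fixing all others. -/
noncomputable def coordMap (j : Fin d) (H : ℝ → ℝ) (x : 𝔼) : 𝔼 :=
  x + (H (x j) - x j) • EuclideanSpace.single j (1 : ℝ)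

theorem coordMap_apply (j : Fin d) (H : ℝ → ℝ) (x : 𝔼) (i : Fin d) :
    coordMap j H x i = if i = j then H (x j) else x i := by
  unfold coordMap
  by_cases h : i = j
  · subst h; simp
  · simp [h]

theorem coordMap_coordMap (j : Fin d) (H G : ℝ → ℝ) (x : 𝔼) :
    coordMap j H (coordMap j G x) = coordMap j (fun s => H (G s)) x := by
  ext i
  by_cases h : i = j <;> simp [coordMap_apply, h]

theorem continuous_coordMap (j : Fin d) {H : ℝ → ℝ} (hH : Continuous H) :
    Continuous (coordMap j H : 𝔼 → 𝔼) := by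
  unfold coordMap
  fun_prop

theorem NetApprox.coordMap_comp {j : Fin d} {H G : ℝ → ℝ} (hH : NetApprox α (coordMap j H))
    (hG : NetApprox α (coordMap j G)) : NetApprox α (coordMap j (fun s => H (G s))) := by
  simpa only [coordMap_coordMap] using hH.comp hG

theorem netApprox_coordMap_affine (j : Fin d) (c b : ℝ) :
    NetApprox α (coordMap j (fun s => c * s + b)) := by
  have h := (isNet_affine (α := α) ((LinearMap.id : 𝔼 →ₗ[ℝ] 𝔼) + (c - 1) •
    ((EuclideanSpace.proj j : 𝔼 →L[ℝ] ℝ) : 𝔼 →ₗ[ℝ] ℝ).smulRight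
      (EuclideanSpace.single j (1 : ℝ))) (b • EuclideanSpace.single j (1 : ℝ))).netApprox
  convert h using 2 with x
  ext i
  by_cases hi : i = j
  · subst hi; simp [coordMap_apply]; ring
  · simp [coordMap_apply, hi]

theorem abs_apply_le_norm (x : 𝔼) (i : Fin d) : |x i| ≤ ‖x‖ := by
  simpa using PiLp.norm_apply_le x i

theorem netApprox_coordMap_leakyReLU (hα : α ∈ Set.Ioo (0 : ℝ) 1) (j : Fin d) :
    NetApprox α (coordMap j (leakyReLU α)) := by
  refine ⟨continuous_coordMap j (by unfold leakyReLU; fun_prop), fun R ε hε => ?_⟩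
  -- Shifting the other coordinates by `R` makes them nonnegative on the ball, where the activation
  -- does not affect them.
  let p : 𝔼 := WithLp.toLp 2 (fun i => if i = j then 0 else R)
  refine ⟨_, (isNet_affine LinearMap.id (-p)).comp
    (isNet_leakyReLUVec.comp (isNet_affine LinearMap.id p)), fun x hx => ?_⟩
  refine le_of_eq_of_le ?_ hε.le
  rw [norm_eq_zero, sub_eq_zero]
  ext i
  by_cases hi : i = j
  · subst hi
    simp [coordMap_apply, leakyReLUVec, p]
  · have h1 : 0 ≤ x i + R := by linarith [(abs_le.1 ((abs_apply_le_norm x i).trans hx)).1]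
    have h2 : α * (x i + R) ≤ x i + R := by nlinarith [hα.2]
    simp [coordMap_apply, leakyReLUVec, p, hi, leakyReLU, max_eq_right h2]

theorem leakyReLU_of_nonneg (hα : α ∈ Set.Ioo (0 : ℝ) 1) {s : ℝ} (hs : 0 ≤ s) :
    leakyReLU α s = s :=
  max_eq_right (by nlinarith [hα.2])

theorem leakyReLU_of_nonpos (hα : α ∈ Set.Ioo (0 : ℝ) 1) {s : ℝ} (hs : s ≤ 0) :
    leakyReLU α s = α * s :=
  max_eq_left (by nlinarith [hα.2])

/-- These `r` are the ratios of two slopes from `{α, 1}`. The ratio `α` comes from reflecting the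
activation, `1 / α` from rescaling it. -/
theorem exists_netApprox_bend (hα : α ∈ Set.Ioo (0 : ℝ) 1) (j : Fin d) (q : ℝ) {r : ℝ}
    (hr : r = 1 ∨ r = α ∨ r = 1 / α) :
    ∃ B : ℝ → ℝ, NetApprox α (coordMap j B) ∧ (∀ s ≤ q, B s = s) ∧
      ∀ s, q ≤ s → B s = q + r * (s - q) := by
  have h0 := hα.1
  have hσ := netApprox_coordMap_leakyReLU hα j
  rcases hr with rfl | rfl | rfl
  · exact ⟨fun s => 1 * s + 0, netApprox_coordMap_affine j 1 0, fun s _ => by ring,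
      fun s _ => by ring⟩
  · refine ⟨_, (netApprox_coordMap_affine j (-1) q).coordMap_comp
      (hσ.coordMap_comp (netApprox_coordMap_affine j (-1) q)), fun s hs => ?_, fun s hs => ?_⟩
    · rw [leakyReLU_of_nonneg hα (by linarith)]; ring
    · rw [leakyReLU_of_nonpos hα (by linarith)]; ring
  · refine ⟨_, (netApprox_coordMap_affine j (1 / α) q).coordMap_comp
      (hσ.coordMap_comp (netApprox_coordMap_affine j 1 (-q))), fun s hs => ?_, fun s hs => ?_⟩
    · rw [leakyReLU_of_nonpos hα (by linarith)]; field_simp; ring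
    · rw [leakyReLU_of_nonneg hα (by linarith)]; field_simp; ring

/-- A zigzag with slopes in `{α, 1}` follows any function whose slopes lie between `α` and `1`. -/
theorem exists_zigzag (hα : α ∈ Set.Ioo (0 : ℝ) 1) (j : Fin d) {H : ℝ → ℝ}
    (hH : ∀ x y, x ≤ y → α * (y - x) ≤ H y - H x ∧ H y - H x ≤ y - x) (x₀ : ℝ) {δ : ℝ}
    (hδ : 0 ≤ δ) (n : ℕ) :
    ∃ (f : ℝ → ℝ) (s : ℝ), NetApprox α (coordMap j f) ∧ (s = 1 ∨ s = α) ∧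
      (∀ x ≤ x₀ + n * δ, f x ≤ f (x₀ + n * δ)) ∧
      (∀ x, x₀ + n * δ ≤ x → f x = f (x₀ + n * δ) + s * (x - (x₀ + n * δ))) ∧
      ∀ x, x₀ ≤ x → x ≤ x₀ + n * δ → |f x - H x| ≤ δ := by
  have h0 := hα.1
  have h1 := hα.2
  induction n with
  | zero =>
    refine ⟨fun s => 1 * s + (H x₀ - x₀), 1, netApprox_coordMap_affine j _ _, Or.inl rfl,
      fun x hx => by simp at hx ⊢; linarith, fun x _ => by simp; ring, fun x hx hx' => ?_⟩
    have : x = x₀ := le_antisymm (by simpa using hx') hx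
    subst this
    simpa using hδ
  | succ n ih =>
    obtain ⟨f, s, hf, hs, hmono, haff, herr⟩ := ih
    have hp : x₀ + ((n + 1 : ℕ) : ℝ) * δ = x₀ + n * δ + δ := by push_cast; ring
    rw [hp]
    have hxp : x₀ ≤ x₀ + n * δ := by nlinarith [(Nat.cast_nonneg n : (0 : ℝ) ≤ n)]
    generalize x₀ + n * δ = p at *
    have hs0 : 0 < s := by rcases hs with rfl | rfl <;> linarith
    -- Greedy choice: steep when `f` is not above `H`, flat when it is. The error then moves towards
    -- zero, and past it by at most `(1 - α) * δ`.
    obtain ⟨t, ht, htp, htn⟩ : ∃ t : ℝ, (t = 1 ∨ t = α) ∧ (f p ≤ H p → t = 1) ∧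
        (H p < f p → t = α) := by
      by_cases h : f p ≤ H p
      · exact ⟨1, Or.inl rfl, fun _ => rfl, fun h' => absurd h (not_le.2 h')⟩
      · exact ⟨α, Or.inr rfl, fun h' => absurd h' h, fun _ => rfl⟩
    have ht0 : 0 < t := by rcases ht with rfl | rfl <;> linarith
    have hr : t / s = 1 ∨ t / s = α ∨ t / s = 1 / α := by
      rcases ht with rfl | rfl <;> rcases hs with rfl | rfl <;> simp [h0.ne']
    -- Values up to `f p` are exactly those taken left of `p`, so bending the output there changes
    -- the slope from `s` to `t` only to the right of `p`.
    obtain ⟨B, hB, hBl, hBr⟩ := exists_netApprox_bend hα j (f p) hr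
    have hl : ∀ x ≤ p, B (f x) = f x := fun x hx => hBl _ (hmono x hx)
    have hrr : ∀ x, p ≤ x → B (f x) = f p + t * (x - p) := by
      intro x hx
      have : f p ≤ f x := by rw [haff x hx]; nlinarith
      rw [hBr _ this, haff x hx]
      field_simp
      ring
    refine ⟨_, t, hB.coordMap_comp hf, ht, fun x hx => ?_, fun x hx => ?_, fun x hx hx' => ?_⟩
    · rw [hrr (p + δ) (by linarith)]
      rcases le_total x p with h | h
      · rw [hl x h]; nlinarith [hmono x h]
      · rw [hrr x h]; nlinarith
    · rw [hrr x (by linarith), hrr (p + δ) (by linarith)]; ring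
    · rcases le_total x p with h | h
      · rw [hl x h]; exact herr x hx h
      · rw [hrr x h]
        have hpe := abs_le.1 (herr p hxp le_rfl)
        obtain ⟨hH1, hH2⟩ := hH p x h
        rw [abs_le]
        have hxp' : x - p ≤ δ := by linarith
        rcases le_or_gt (f p) (H p) with hc | hc
        · rw [htp hc]
          constructor <;> nlinarith
        · rw [htn hc]
          constructor <;> nlinarith

theorem netApprox_coordMap_of_slope_mem (hα : α ∈ Set.Ioo (0 : ℝ) 1) (j : Fin d) {H : ℝ → ℝ}
    (hH : ∀ x y, x ≤ y → α * (y - x) ≤ H y - H x ∧ H y - H x ≤ y - x) :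
    NetApprox α (coordMap j H) := by
  have hlip : LipschitzWith 1 H := by
    refine LipschitzWith.of_le_add fun x y => ?_
    rw [Real.dist_eq]
    rcases le_total x y with h | h
    · nlinarith [(hH x y h).1, abs_nonneg (x - y), hα.1]
    · linarith [(hH y x h).2, le_abs_self (x - y)]
  refine netApprox_of_limit (continuous_coordMap j hlip.continuous) fun R ε hε => ?_
  obtain ⟨n, hn⟩ := exists_nat_gt (2 * R / ε)
  rw [div_lt_iff₀ hε] at hn
  obtain ⟨f, s, hf, -, -, -, herr⟩ := exists_zigzag hα j hH (-R) hε.le n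
  refine ⟨_, hf, fun x hx => ?_⟩
  have hxj := abs_le.1 ((abs_apply_le_norm x j).trans hx)
  have h : coordMap j f x - coordMap j H x
      = (f (x j) - H (x j)) • EuclideanSpace.single j (1 : ℝ) := by
    unfold coordMap
    module
  rw [h, norm_smul]
  simpa using herr (x j) hxj.1 (by linarith [hxj.2])

/-- The map moving `x` along the `j`-th axis as a function of `ℓ x`. -/
theorem netApprox_add_smul_single (hα : α ∈ Set.Ioo (0 : ℝ) 1) (j : Fin d) (ℓ : 𝔼 →ₗ[ℝ] ℝ)
    (hℓ : ℓ (EuclideanSpace.single j 1) = 1) {c : ℝ} (hc : 0 < c) {H : ℝ → ℝ}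
    (hH : ∀ x y, x ≤ y → α * c * (y - x) ≤ H y - H x ∧ H y - H x ≤ c * (y - x)) :
    NetApprox α (fun x => x + (H (ℓ x) - ℓ x) • EuclideanSpace.single j (1 : ℝ)) := by
  have h1 : NetApprox α (coordMap j (fun s => c * (c⁻¹ * H s) + 0)) := by
    refine (netApprox_coordMap_affine j c 0).coordMap_comp
      (netApprox_coordMap_of_slope_mem hα j fun x y hxy => ?_)
    obtain ⟨ha, hb⟩ := hH x y hxy
    rw [← mul_sub]
    constructor
    · rw [le_inv_mul_iff₀ hc]; linarith
    · rw [inv_mul_le_iff₀ hc]; linarith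
  simp only [mul_inv_cancel_left₀ hc.ne', add_zero] at h1
  -- `ℓ - pr` vanishes on `e_j`, so `hP` and `hQ` concern mutually inverse shears; the first puts `ℓ
  -- x` into coordinate `j`.
  let pr : 𝔼 →ₗ[ℝ] ℝ := ((EuclideanSpace.proj j : 𝔼 →L[ℝ] ℝ) : 𝔼 →ₗ[ℝ] ℝ)
  have hP := (isNet_affine (α := α) ((LinearMap.id : 𝔼 →ₗ[ℝ] 𝔼) +
    (ℓ - pr).smulRight (EuclideanSpace.single j (1 : ℝ))) 0).netApprox
  have hQ := (isNet_affine (α := α) ((LinearMap.id : 𝔼 →ₗ[ℝ] 𝔼) +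
    (pr - ℓ).smulRight (EuclideanSpace.single j (1 : ℝ))) 0).netApprox
  convert hQ.comp (h1.comp hP) using 2 with x
  simp [coordMap, pr, hℓ]
  module

end CoordinateMaps

/-! ### Every continuous field is a tangent field. -/

section TangentFields

variable {d : ℕ} {α : ℝ}

local notation "𝔼" => EuclideanSpace ℝ (Fin d)

/-- The vector fields `U` for which `z ↦ z + h U(z)` is approximated by networks up to `o(h)`,
uniformly on balls. -/
def TangentField (α : ℝ) (U : 𝔼 → 𝔼) : Prop :=
  ∀ R ε : ℝ, 0 < ε → ∃ h₀, 0 < h₀ ∧ ∀ h, 0 < h → h ≤ h₀ →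
    ∃ F, NetApprox α F ∧ ∀ z, ‖z‖ ≤ R → ‖F z - z - h • U z‖ ≤ ε * h

theorem tangentField_of_limit {U : 𝔼 → 𝔼}
    (H : ∀ R ε : ℝ, 0 < ε → ∃ V, TangentField α V ∧ ∀ z, ‖z‖ ≤ R → ‖V z - U z‖ ≤ ε) :
    TangentField α U := by
  intro R ε hε
  obtain ⟨V, hV, hVU⟩ := H R (ε / 2) (half_pos hε)
  obtain ⟨h₀, hh₀, hF⟩ := hV R (ε / 2) (half_pos hε)
  refine ⟨h₀, hh₀, fun h hh hle => ?_⟩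
  obtain ⟨F, hFA, hF⟩ := hF h hh hle
  refine ⟨F, hFA, fun z hz => ?_⟩
  calc ‖F z - z - h • U z‖ = ‖(F z - z - h • V z) + h • (V z - U z)‖ := by
        congr 1; module
    _ ≤ ‖F z - z - h • V z‖ + h * ‖V z - U z‖ := by
        refine (norm_add_le _ _).trans_eq ?_
        rw [norm_smul, Real.norm_of_nonneg hh.le]
    _ ≤ ε * h := by nlinarith [hF z hz, hVU z hz]

theorem tangentField_const (c : 𝔼) : TangentField α (fun _ => c) := by
  refine fun R ε hε => ⟨1, one_pos, fun h hh _ =>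
    ⟨_, (isNet_affine LinearMap.id (h • c)).netApprox, fun z _ => ?_⟩⟩
  simpa using (mul_pos hε hh).le

theorem TangentField.add {U V : 𝔼 → 𝔼} (hU : TangentField α U) (hV : TangentField α V)
    (hUc : Continuous U) (hVc : Continuous V) : TangentField α (fun z => U z + V z) := by
  intro R ε hε
  obtain ⟨C, hC0, hC⟩ := exists_norm_le_of_continuous hUc R
  obtain ⟨δ, hδ, hVδ⟩ := exists_modulus_of_continuous hVc (R + 1) (ε := ε / 3) (by positivity)
  obtain ⟨h₁, hh₁, hF⟩ := hU R (ε / 3) (by positivity)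
  obtain ⟨h₂, hh₂, hG⟩ := hV (R + 1) (ε / 3) (by positivity)
  have hD : 0 < C + ε := by positivity
  -- The first step moves points by at most `h * (C + ε)`: they stay in the ball of radius `R + 1`,
  -- and `V` changes by less than `ε / 3`.
  refine ⟨min (min h₁ h₂) (min 1 (δ / 2) / (C + ε)), by positivity, fun h hh hle => ?_⟩
  obtain ⟨F, hFA, hF⟩ := hF h hh (hle.trans ((min_le_left _ _).trans (min_le_left _ _)))
  obtain ⟨G, hGA, hG⟩ := hG h hh (hle.trans ((min_le_left _ _).trans (min_le_right _ _)))
  have hs : h * (C + ε) ≤ min 1 (δ / 2) := (le_div_iff₀ hD).1 (hle.trans (min_le_right _ _))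
  have hs1 := hs.trans (min_le_left _ _)
  have hs2 := hs.trans (min_le_right _ _)
  refine ⟨_, hGA.comp hFA, fun z hz => ?_⟩
  have hFz := hF z hz
  have hdist : ‖F z - z‖ ≤ h * (C + ε) := by
    calc ‖F z - z‖ = ‖(F z - z - h • U z) + h • U z‖ := by congr 1; abel
      _ ≤ ‖F z - z - h • U z‖ + h * ‖U z‖ := by
        refine (norm_add_le _ _).trans_eq ?_
        rw [norm_smul, Real.norm_of_nonneg hh.le]
      _ ≤ h * (C + ε) := by nlinarith [hC z hz, mul_pos hε hh]
  have hFn : ‖F z‖ ≤ R + 1 := by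
    have := norm_le_norm_add_norm_sub' (F z) z
    linarith
  have hVd := hVδ (F z) z hFn (by linarith) (by linarith)
  have hGz := hG (F z) hFn
  calc ‖G (F z) - z - h • (U z + V z)‖
      = ‖(G (F z) - F z - h • V (F z)) + (F z - z - h • U z) + h • (V (F z) - V z)‖ := by
        congr 1; module
    _ ≤ ‖G (F z) - F z - h • V (F z)‖ + ‖F z - z - h • U z‖ + h * ‖V (F z) - V z‖ := by
        refine norm_add₃_le.trans_eq ?_
        rw [norm_smul, Real.norm_of_nonneg hh.le]
    _ ≤ ε * h := by nlinarith

/-- The slopes of `s + h * g s` lie in `[1 - h * K, 1 + h * K]`, which for small `h` lies in `[α *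
c, c]` with `c = 1 + h * K`. The step is then itself a `NetApprox` map, with no error. -/
theorem tangentField_ridge_of_lipschitz (hα : α ∈ Set.Ioo (0 : ℝ) 1) (j : Fin d) (ℓ : 𝔼 →ₗ[ℝ] ℝ)
    (hℓ : ℓ (EuclideanSpace.single j 1) = 1) {K : NNReal} {g : ℝ → ℝ} (hg : LipschitzWith K g) :
    TangentField α (fun z => g (ℓ z) • EuclideanSpace.single j (1 : ℝ)) := by
  intro R ε hε
  have h0 := hα.1
  have h1 : 0 < 1 - α := by linarith [hα.2]
  have hK : (0 : ℝ) ≤ K := K.2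
  refine ⟨(1 - α) / (2 * (K + 1)), by positivity, fun h hh hle => ?_⟩
  rw [le_div_iff₀ (by positivity)] at hle
  have hhK : 0 ≤ h * K := by positivity
  refine ⟨_, netApprox_add_smul_single hα j ℓ hℓ (c := 1 + h * K) (H := fun s => s + h * g s)
    (by positivity) fun x y hxy => ?_, fun z _ => ?_⟩
  · have hd := hg.dist_le_mul y x
    rw [Real.dist_eq, Real.dist_eq, abs_of_nonneg (sub_nonneg.2 hxy)] at hd
    obtain ⟨hd1, hd2⟩ := abs_le.1 hd
    have e1 := mul_le_mul_of_nonneg_left hd1 hh.le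
    have e2 := mul_le_mul_of_nonneg_left hd2 hh.le
    constructor
    · have e3 : α * (1 + h * K) ≤ 1 - h * K := by nlinarith
      have e4 := mul_le_mul_of_nonneg_right e3 (sub_nonneg.2 hxy)
      linarith
    · linarith
  · refine le_of_eq_of_le ?_ (mul_pos hε hh).le
    rw [norm_eq_zero]
    module

/-- The cap makes the exponential globally Lipschitz; on a given ball it can be placed where it is
never active. -/
theorem exists_lipschitzWith_exp_min (c : ℝ) {a : ℝ} (ha : 0 < a) (M : ℝ) :
    ∃ K, LipschitzWith K (fun s => c * Real.exp (a * min s M)) := by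
  refine ⟨(|c| * (Real.exp (a * M) * a)).toNNReal, LipschitzWith.of_dist_le_mul ?_⟩
  have key : ∀ x y : ℝ, x ≤ y →
      Real.exp (a * min y M) - Real.exp (a * min x M) ≤ Real.exp (a * M) * a * (y - x) := by
    intro x y hxy
    have hm : min x M ≤ min y M := min_le_min_right _ hxy
    have hd : min y M - min x M ≤ y - x := by
      rcases le_total x M with h | h
      · rw [min_eq_left h]; linarith [min_le_left y M]
      · rw [min_eq_right h]; linarith [min_le_right y M]
    have e1 := Real.add_one_le_exp (a * min x M - a * min y M)
    have e2 : Real.exp (a * min x M) =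
        Real.exp (a * min y M) * Real.exp (a * min x M - a * min y M) := by
      rw [← Real.exp_add]; congr 1; ring
    have e3 : Real.exp (a * min y M) ≤ Real.exp (a * M) :=
      Real.exp_le_exp.2 (by nlinarith [min_le_right y M])
    have e4 := Real.exp_pos (a * min y M)
    have e5 := mul_le_mul_of_nonneg_left e1 e4.le
    calc Real.exp (a * min y M) - Real.exp (a * min x M)
        ≤ Real.exp (a * min y M) * (a * (min y M - min x M)) := by rw [e2]; linarith
      _ ≤ Real.exp (a * M) * (a * (y - x)) := by
          refine mul_le_mul e3 (mul_le_mul_of_nonneg_left hd ha.le) ?_ (Real.exp_pos _).le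
          exact mul_nonneg ha.le (sub_nonneg.2 hm)
      _ = _ := by ring
  intro x y
  rw [Real.coe_toNNReal _ (by positivity), Real.dist_eq, Real.dist_eq, ← mul_sub, abs_mul,
    mul_assoc]
  refine mul_le_mul_of_nonneg_left ?_ (abs_nonneg _)
  rcases le_total x y with h | h
  · have hm : Real.exp (a * min x M) ≤ Real.exp (a * min y M) :=
      Real.exp_le_exp.2 (mul_le_mul_of_nonneg_left (min_le_min_right _ h) ha.le)
    rw [abs_sub_comm, abs_sub_comm x, abs_of_nonneg (sub_nonneg.2 hm),
      abs_of_nonneg (sub_nonneg.2 h)]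
    exact key x y h
  · have hm : Real.exp (a * min y M) ≤ Real.exp (a * min x M) :=
      Real.exp_le_exp.2 (mul_le_mul_of_nonneg_left (min_le_min_right _ h) ha.le)
    rw [abs_of_nonneg (sub_nonneg.2 hm), abs_of_nonneg (sub_nonneg.2 h)]
    exact key y x h

theorem tangentField_exp (hα : α ∈ Set.Ioo (0 : ℝ) 1) (j : Fin d) (w : 𝔼 →L[ℝ] ℝ)
    (hw : 0 < w (EuclideanSpace.single j 1)) (c : ℝ) :
    TangentField α (fun z => (c * Real.exp (w z)) • EuclideanSpace.single j (1 : ℝ)) := by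
  refine tangentField_of_limit fun R ε hε => ?_
  set a := w (EuclideanSpace.single j 1) with ha
  obtain ⟨K, hK⟩ := exists_lipschitzWith_exp_min c hw (‖w‖ * R / a)
  refine ⟨_, tangentField_ridge_of_lipschitz hα j (a⁻¹ • (w : 𝔼 →ₗ[ℝ] ℝ)) ?_ hK, fun z hz => ?_⟩
  · simp [← ha, hw.ne']
  · have h1 : w z ≤ ‖w‖ * R := (le_abs_self _).trans
      ((w.le_opNorm z).trans (mul_le_mul_of_nonneg_left hz (norm_nonneg _)))
    have h2 : min (a⁻¹ * w z) (‖w‖ * R / a) = a⁻¹ * w z := by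
      refine min_eq_left ?_
      rw [div_eq_inv_mul]
      exact mul_le_mul_of_nonneg_left h1 (inv_pos.2 hw).le
    simp [h2, mul_inv_cancel_left₀ hw.ne', hε.le]

/-- The functions `exp ∘ w` with `w` linear and either zero or increasing along the `j`-th axis. -/
def expMonoid (j : Fin d) : Submonoid C(𝔼, ℝ) where
  carrier := {p | ∃ w : 𝔼 →L[ℝ] ℝ, (w = 0 ∨ 0 < w (EuclideanSpace.single j 1)) ∧
    ∀ z, p z = Real.exp (w z)}
  one_mem' := ⟨0, Or.inl rfl, fun z => by simp⟩
  mul_mem' := by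
    rintro p q ⟨w, hw, hp⟩ ⟨w', hw', hq⟩
    refine ⟨w + w', ?_, fun z => by simp [hp, hq, Real.exp_add]⟩
    rcases hw with rfl | hw <;> rcases hw' with rfl | hw'
    · simp
    · simp [hw']
    · simp [hw]
    · right
      simpa using add_pos hw hw'

theorem tangentField_of_mem_adjoin (hα : α ∈ Set.Ioo (0 : ℝ) 1) (j : Fin d) {p : C(𝔼, ℝ)}
    (hp : p ∈ Algebra.adjoin ℝ (expMonoid j : Set C(𝔼, ℝ))) :
    TangentField α (fun z => p z • EuclideanSpace.single j (1 : ℝ)) := by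
  -- Products of these exponentials are again such exponentials, so the algebra is their linear span
  -- and only sums of fields are needed.
  rw [← Subalgebra.mem_toSubmodule, Algebra.adjoin_eq_span, Submonoid.closure_eq] at hp
  suffices h : ∀ c : ℝ, TangentField α (fun z => (c * p z) • EuclideanSpace.single j (1 : ℝ)) by
    simpa using h 1
  induction hp using Submodule.span_induction with
  | mem p hp =>
    intro c
    obtain ⟨w, hw, hp⟩ := hp
    simp only [hp]
    rcases hw with rfl | hw
    · simpa using tangentField_const (α := α) (c • EuclideanSpace.single j (1 : ℝ))
    · exact tangentField_exp hα j w hw c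
  | zero => intro c; simpa using tangentField_const (α := α) (0 : 𝔼)
  | add p q _ _ hp hq =>
    intro c
    simp only [ContinuousMap.add_apply, mul_add, add_smul]
    exact (hp c).add (hq c) (by fun_prop) (by fun_prop)
  | smul a p _ hp =>
    intro c
    simpa [mul_assoc] using hp (c * a)

theorem separatesPoints_adjoin_expMonoid (j : Fin d) :
    (Algebra.adjoin ℝ (expMonoid j : Set C(𝔼, ℝ))).SeparatesPoints := by
  intro x y hxy
  have key : ∃ w : 𝔼 →L[ℝ] ℝ, 0 < w (EuclideanSpace.single j 1) ∧ w x ≠ w y := by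
    let pr (i : Fin d) : 𝔼 →L[ℝ] ℝ := EuclideanSpace.proj i
    by_cases hj : x j = y j
    · obtain ⟨i, hi⟩ : ∃ i, x i ≠ y i := by
        by_contra! h
        exact hxy (by ext i; exact h i)
      have hij : j ≠ i := by rintro rfl; exact hi hj
      -- The summand `pr j` keeps the functional increasing along `e_j`; `pr i` separates the
      -- points.
      exact ⟨pr j + pr i, by simp [pr, hij], by simpa [pr, hj] using hi⟩
    · exact ⟨pr j, by simp [pr], by simpa [pr] using hj⟩
  obtain ⟨w, hw, hne⟩ := key
  refine ⟨_, ⟨⟨fun z => Real.exp (w z), by fun_prop⟩, Algebra.subset_adjoin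
    ⟨w, Or.inr hw, fun z => rfl⟩, rfl⟩, ?_⟩
  simpa using hne

theorem tangentField_smul_single (hα : α ∈ Set.Ioo (0 : ℝ) 1) (j : Fin d) {g : 𝔼 → ℝ}
    (hg : Continuous g) :
    TangentField α (fun z => g z • EuclideanSpace.single j (1 : ℝ)) := by
  refine tangentField_of_limit fun R ε hε => ?_
  obtain ⟨p, hp, hpg⟩ :=
    ContinuousMap.exists_mem_subalgebra_near_continuous_of_isCompact_of_separatesPoints
      (separatesPoints_adjoin_expMonoid j) ⟨g, hg⟩ (isCompact_closedBall (0 : 𝔼) R) hε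
  refine ⟨_, tangentField_of_mem_adjoin hα j hp, fun z hz => ?_⟩
  rw [← sub_smul, norm_smul]
  simpa using (hpg z (by simpa using hz)).le

theorem tangentField_of_continuous (hα : α ∈ Set.Ioo (0 : ℝ) 1) {U : 𝔼 → 𝔼}
    (hU : Continuous U) : TangentField α U := by
  have hsum : ∀ s : Finset (Fin d),
      TangentField α (fun z => ∑ j ∈ s, U z j • EuclideanSpace.single j (1 : ℝ)) := by
    intro s
    induction s using Finset.induction_on with
    | empty => simpa using tangentField_const (α := α) (0 : 𝔼)
    | insert j s hj ih =>
      simp only [Finset.sum_insert hj]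
      exact (tangentField_smul_single hα j (by fun_prop)).add ih (by fun_prop) (by fun_prop)
  convert hsum Finset.univ using 2 with z
  ext i
  simp [Finset.sum_apply, Pi.single_apply]

end TangentFields

/-! ### A step size uniform over a compact family of fields. -/

section UniformStep

variable {d : ℕ} {α : ℝ}

local notation "𝔼" => EuclideanSpace ℝ (Fin d)

open BoundedContinuousFunction in
-- Vanishing at `0` confines the values to a ball of radius `K * R`, and the common Lipschitz
-- constant gives equicontinuity.
theorem totallyBounded_lipschitz_restrictions (K : NNReal) (R : ℝ) :
    TotallyBounded {f : (Metric.closedBall (0 : 𝔼) R) →ᵇ 𝔼 |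
      ∃ U : 𝔼 → 𝔼, LipschitzWith K U ∧ U 0 = 0 ∧ ∀ x, f x = U x} := by
  refine (BoundedContinuousFunction.arzela_ascoli (Metric.closedBall (0 : 𝔼) (K * R))
    (isCompact_closedBall _ _) _ ?_ ?_).totallyBounded.subset subset_closure
  · rintro f x ⟨U, hU, hU0, hf⟩
    have h := hU.dist_le_mul x 0
    have hx : dist (x : 𝔼) 0 ≤ R := x.2
    rw [Metric.mem_closedBall, hf]
    rw [hU0] at h
    exact h.trans (mul_le_mul_of_nonneg_left hx K.2)
  · refine UniformEquicontinuous.equicontinuous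
      (LipschitzWith.uniformEquicontinuous _ K ?_)
    rintro ⟨f, U, hU, -, hf⟩
    refine LipschitzWith.of_dist_le_mul fun x y => ?_
    change dist (f x) (f y) ≤ _
    rw [hf, hf]
    exact hU.dist_le_mul (x : 𝔼) y

/-- For Lipschitz fields vanishing at the origin, the admissible step size depends only on the
Lipschitz constant, the radius and the tolerance. -/
theorem exists_uniform_step (hα : α ∈ Set.Ioo (0 : ℝ) 1) (K : NNReal) (R : ℝ) {ε : ℝ}
    (hε : 0 < ε) :
    ∃ h₀, 0 < h₀ ∧ ∀ h, 0 < h → h ≤ h₀ → ∀ U : 𝔼 → 𝔼, LipschitzWith K U → U 0 = 0 →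
      ∃ F, NetApprox α F ∧ ∀ z, ‖z‖ ≤ R → ‖F z - z - h • U z‖ ≤ ε * h := by
  obtain ⟨t, htS, htf, hcov⟩ := Metric.finite_approx_of_totallyBounded
    (totallyBounded_lipschitz_restrictions (d := d) K R) (ε / 2) (half_pos hε)
  -- Finitely many net fields share one step size; any other field borrows the step of a nearby one.
  have hev : ∀ᶠ h in nhdsWithin (0 : ℝ) (Set.Ioi 0), ∀ f ∈ t,
      ∃ F : 𝔼 → 𝔼, NetApprox α F ∧ ∀ z : Metric.closedBall (0 : 𝔼) R,
        ‖F z - (z : 𝔼) - h • f z‖ ≤ ε / 2 * h := by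
    rw [Filter.eventually_all_finite htf]
    intro f hf
    obtain ⟨U, hU, -, hfU⟩ := htS hf
    obtain ⟨h₀, hh₀, hF⟩ := tangentField_of_continuous hα hU.continuous R (ε / 2) (half_pos hε)
    filter_upwards [Ioc_mem_nhdsGT hh₀] with h hh
    obtain ⟨F, hFA, hF⟩ := hF h hh.1 hh.2
    refine ⟨F, hFA, fun z => ?_⟩
    rw [hfU]
    exact hF z (mem_closedBall_zero_iff.1 z.2)
  obtain ⟨h₀, hh₀, hsub⟩ := mem_nhdsGT_iff_exists_Ioc_subset.1 hev
  refine ⟨h₀, hh₀, fun h hh hle U hU hU0 => ?_⟩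
  let f : BoundedContinuousFunction (Metric.closedBall (0 : 𝔼) R) 𝔼 :=
    BoundedContinuousFunction.mkOfCompact
      ⟨fun x => U x, hU.continuous.comp continuous_subtype_val⟩
  have hfm := hcov (show f ∈ _ from ⟨U, hU, hU0, fun x => rfl⟩)
  obtain ⟨g, hg, hfg⟩ := Set.mem_iUnion₂.1 hfm
  obtain ⟨F, hFA, hF⟩ := hsub ⟨hh, hle⟩ g hg
  refine ⟨F, hFA, fun z hz => ?_⟩
  let z' : Metric.closedBall (0 : 𝔼) R := ⟨z, by simpa using hz⟩
  have h1 : ‖g z' - U z‖ ≤ ε / 2 := by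
    rw [← dist_eq_norm, dist_comm]
    exact (BoundedContinuousFunction.dist_coe_le_dist (f := f) (g := g) z').trans
      (Metric.mem_ball.1 hfg).le
  calc ‖F z - z - h • U z‖ = ‖(F z - z - h • g z') + h • (g z' - U z)‖ := by
        congr 1; module
    _ ≤ ‖F z - z - h • g z'‖ + h * ‖g z' - U z‖ := by
        refine (norm_add_le _ _).trans_eq ?_
        rw [norm_smul, Real.norm_of_nonneg hh.le]
    _ ≤ ε * h := by nlinarith [hF z']

end UniformStep

/-! ### Euler steps for integral solutions. -/

section Discretization

variable {d : ℕ} {α : ℝ}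

local notation "𝔼" => EuclideanSpace ℝ (Fin d)

/-- `y` solves the integral form of `y' = u(y,t)` on `[0,τ]`. -/
def IsIntegralSolution (u : 𝔼 → ℝ → 𝔼) (τ : ℝ) (y : ℝ → 𝔼) : Prop :=
  ContinuousOn y (Set.Icc 0 τ) ∧ ∀ a b, 0 ≤ a → a ≤ b → b ≤ τ →
    IntervalIntegrable (fun s => u (y s) s) MeasureTheory.volume a b ∧
      y b - y a = ∫ s in a..b, u (y s) s

variable {u : EuclideanSpace ℝ (Fin d) → ℝ → EuclideanSpace ℝ (Fin d)} {τ : ℝ} {K : NNReal}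

theorem norm_le_mul_norm_of_lipschitz {U : 𝔼 → 𝔼} (hU : LipschitzWith K U) (hU0 : U 0 = 0)
    (z : 𝔼) : ‖U z‖ ≤ K * ‖z‖ := by
  simpa [dist_eq_norm, hU0] using hU.dist_le_mul z 0

theorem IsIntegralSolution.norm_sub_le (hu : ∀ t, LipschitzWith K (fun z => u z t))
    (hu0 : ∀ t, u 0 t = 0) {y : ℝ → 𝔼} (hy : IsIntegralSolution u τ y) {M a b : ℝ} (ha : 0 ≤ a)
    (hab : a ≤ b) (hb : b ≤ τ) (hM : ∀ s, a ≤ s → s ≤ b → ‖y s‖ ≤ M) :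
    ‖y b - y a‖ ≤ K * M * (b - a) := by
  rw [(hy.2 a b ha hab hb).2]
  have h := intervalIntegral.norm_integral_le_of_norm_le_const (a := a) (b := b)
    (f := fun s => u (y s) s) (C := K * M) ?_
  · rwa [abs_of_nonneg (sub_nonneg.2 hab)] at h
  · intro s hs
    rw [Set.uIoc_of_le hab] at hs
    exact (norm_le_mul_norm_of_lipschitz (hu s) (hu0 s) _).trans
      (mul_le_mul_of_nonneg_left (hM s hs.1.le hs.2) K.2)

/-- At a maximum point `c` of the norm, `‖y c‖ ≤ ‖y a‖ + ‖y c‖ / 2`. -/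
theorem IsIntegralSolution.norm_le_two_mul (hu : ∀ t, LipschitzWith K (fun z => u z t))
    (hu0 : ∀ t, u 0 t = 0) {y : ℝ → 𝔼} (hy : IsIntegralSolution u τ y) {a b : ℝ} (ha : 0 ≤ a)
    (hab : a ≤ b) (hb : b ≤ τ) (hK : K * (b - a) ≤ 1 / 2) : ‖y b‖ ≤ 2 * ‖y a‖ := by
  obtain ⟨c, hc, hmax⟩ := isCompact_Icc.exists_isMaxOn (Set.nonempty_Icc.2 hab)
    ((hy.1.mono (Set.Icc_subset_Icc ha hb)).norm)
  have hm : ∀ s, a ≤ s → s ≤ b → ‖y s‖ ≤ ‖y c‖ := fun s h1 h2 => hmax ⟨h1, h2⟩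
  have h1 := hy.norm_sub_le hu hu0 ha hc.1 (hc.2.trans hb)
    (fun s h1 h2 => hm s h1 (h2.trans hc.2))
  have h2 : K * ‖y c‖ * (c - a) ≤ 1 / 2 * ‖y c‖ := by
    have : K * (c - a) ≤ 1 / 2 :=
      (mul_le_mul_of_nonneg_left (by linarith [hc.2]) K.2).trans hK
    nlinarith [norm_nonneg (y c)]
  have h3 := norm_le_norm_add_norm_sub' (y c) (y a)
  linarith [hm b hab le_rfl]

theorem exists_integralSolution_bound (hu : ∀ t, LipschitzWith K (fun z => u z t))
    (hu0 : ∀ t, u 0 t = 0) : ∃ C : ℝ, 0 ≤ C ∧ ∀ y, IsIntegralSolution u τ y →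
      ∀ s, 0 ≤ s → s ≤ τ → ‖y s‖ ≤ C * ‖y 0‖ := by
  have hK : (0 : ℝ) ≤ K := K.2
  obtain ⟨δ, hδ, hKδ⟩ : ∃ δ : ℝ, 0 < δ ∧ K * δ ≤ 1 / 2 := by
    refine ⟨1 / (2 * (K + 1)), by positivity, ?_⟩
    rw [mul_one_div, div_le_div_iff₀ (by positivity) (by positivity)]
    linarith
  have key : ∀ n : ℕ, ∀ y, IsIntegralSolution u τ y → ∀ s, 0 ≤ s → s ≤ τ → s ≤ n * δ →
      ‖y s‖ ≤ 2 ^ n * ‖y 0‖ := by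
    intro n y hy
    induction n with
    | zero =>
      intro s hs _ hsn
      have : s = 0 := le_antisymm (by simpa using hsn) hs
      simp [this]
    | succ n ih =>
      intro s hs hsτ hsn
      push_cast at hsn
      have hm : max 0 (s - δ) ≤ s := max_le hs (by linarith)
      have h1 := hy.norm_le_two_mul hu hu0 (le_max_left 0 (s - δ)) hm hsτ
        ((mul_le_mul_of_nonneg_left (by linarith [le_max_right 0 (s - δ)]) hK).trans hKδ)
      have h2 := ih _ (le_max_left 0 (s - δ)) (hm.trans hsτ)
        (max_le (by positivity) (by linarith))
      rw [pow_succ]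
      linarith
  obtain ⟨n, hn⟩ := exists_nat_gt (τ / δ)
  rw [div_lt_iff₀ hδ] at hn
  exact ⟨2 ^ n, by positivity, fun y hy s hs hsτ => key n y hy s hs hsτ (hsτ.trans hn.le)⟩

theorem intervalIntegrable_of_lipschitz (hu : ∀ t, LipschitzWith K (fun z => u z t))
    (hu0 : ∀ t, u 0 t = 0)
    (hmeas : ∀ z, MeasureTheory.AEStronglyMeasurable (u z) MeasureTheory.volume)
    (z : 𝔼) (a b : ℝ) : IntervalIntegrable (u z) MeasureTheory.volume a b := by
  refine (intervalIntegrable_const (c := K * ‖z‖)).mono_fun (hmeas z).restrict ?_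
  refine Filter.Eventually.of_forall fun t => ?_
  rw [Real.norm_of_nonneg (by positivity)]
  exact norm_le_mul_norm_of_lipschitz (hu t) (hu0 t) z

theorem norm_integral_sub_integral_le (hu : ∀ t, LipschitzWith K (fun z => u z t))
    (hu0 : ∀ t, u 0 t = 0)
    (hmeas : ∀ z, MeasureTheory.AEStronglyMeasurable (u z) MeasureTheory.volume)
    (z w : 𝔼) {a b : ℝ} (hab : a ≤ b) :
    ‖(∫ s in a..b, u z s) - ∫ s in a..b, u w s‖ ≤ K * ‖z - w‖ * (b - a) := by
  have hint := intervalIntegrable_of_lipschitz hu hu0 hmeas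
  rw [← intervalIntegral.integral_sub (hint z a b) (hint w a b),
    ← abs_of_nonneg (sub_nonneg.2 hab)]
  refine intervalIntegral.norm_integral_le_of_norm_le_const fun s _ => ?_
  simpa [dist_eq_norm] using (hu s).dist_le_mul z w

theorem IsIntegralSolution.norm_euler_le (hu : ∀ t, LipschitzWith K (fun z => u z t))
    (hu0 : ∀ t, u 0 t = 0)
    (hmeas : ∀ z, MeasureTheory.AEStronglyMeasurable (u z) MeasureTheory.volume)
    {y : ℝ → 𝔼} (hy : IsIntegralSolution u τ y) {M a b : ℝ} (ha : 0 ≤ a)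
    (hab : a ≤ b) (hb : b ≤ τ) (hM : ∀ s, a ≤ s → s ≤ b → ‖y s‖ ≤ M) :
    ‖y b - y a - ∫ s in a..b, u (y a) s‖ ≤ K * (K * M * (b - a)) * (b - a) := by
  have hM0 : 0 ≤ M := (norm_nonneg _).trans (hM a le_rfl hab)
  obtain ⟨hi, he⟩ := hy.2 a b ha hab hb
  rw [he, ← intervalIntegral.integral_sub hi (intervalIntegrable_of_lipschitz hu hu0 hmeas _ a b)]
  have h := intervalIntegral.norm_integral_le_of_norm_le_const (a := a) (b := b)
    (f := fun s => u (y s) s - u (y a) s) (C := K * (K * M * (b - a))) ?_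
  · rwa [abs_of_nonneg (sub_nonneg.2 hab)] at h
  · intro s hs
    rw [Set.uIoc_of_le hab] at hs
    have h1 : ‖u (y s) s - u (y a) s‖ ≤ K * ‖y s - y a‖ := by
      simpa [dist_eq_norm] using (hu s).dist_le_mul (y s) (y a)
    have h2 := hy.norm_sub_le hu hu0 ha hs.1.le (hs.2.trans hb)
      (fun t h1 h2 => hM t h1 (h2.trans hs.2))
    refine h1.trans (mul_le_mul_of_nonneg_left (h2.trans ?_) K.2)
    exact mul_le_mul_of_nonneg_left (by linarith [hs.2]) (by positivity)

theorem exists_netApprox_solution_map (hα : α ∈ Set.Ioo (0 : ℝ) 1) (hτ : 0 < τ)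
    (hu : ∀ t, LipschitzWith K (fun z => u z t)) (hu0 : ∀ t, u 0 t = 0)
    (hmeas : ∀ z, MeasureTheory.AEStronglyMeasurable (u z) MeasureTheory.volume)
    {r ε : ℝ} (hr : 0 ≤ r) (hε : 0 < ε) :
    ∃ F, NetApprox α F ∧
      ∀ y, IsIntegralSolution u τ y → ‖y 0‖ ≤ r → ‖F (y 0) - y τ‖ ≤ ε := by
  have hK : (0 : ℝ) ≤ K := K.2
  obtain ⟨C, hC0, hC⟩ := exists_integralSolution_bound (τ := τ) hu hu0
  have hM0 : 0 ≤ C * r := by positivity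
  have hyM : ∀ y, IsIntegralSolution u τ y → ‖y 0‖ ≤ r → ∀ s, 0 ≤ s → s ≤ τ → ‖y s‖ ≤ C * r :=
    fun y hy h0 s hs hsτ => (hC y hy s hs hsτ).trans (mul_le_mul_of_nonneg_left h0 hC0)
  generalize C * r = M at hM0 hyM
  have hE : 0 < τ * Real.exp (K * τ) := by positivity
  -- The accumulated error will be at most `η * τ * exp (K * τ)`. The bound by `1` keeps the
  -- iterates in the ball of radius `M + 1`, where the steps are accurate.
  obtain ⟨η, hη, hηE⟩ : ∃ η : ℝ, 0 < η ∧ η * (τ * Real.exp (K * τ)) = min ε 1 :=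
    ⟨min ε 1 / (τ * Real.exp (K * τ)), by positivity, by field_simp⟩
  obtain ⟨h₀, hh₀, hstep⟩ := exists_uniform_step (d := d) hα K (M + 1) (half_pos hη)
  obtain ⟨N, hN0, hN1, hN2⟩ : ∃ N : ℕ, 0 < N ∧ τ / N ≤ h₀ ∧ K * (K * M * (τ / N)) ≤ η / 2 := by
    have h1 : Filter.Tendsto (fun N : ℕ => τ / (N : ℝ)) Filter.atTop (nhds 0) :=
      tendsto_const_div_atTop_nhds_zero_nat τ
    have h2 : Filter.Tendsto (fun N : ℕ => K * (K * M * (τ / (N : ℝ)))) Filter.atTop (nhds 0) := by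
      simpa using (h1.const_mul (K * M)).const_mul (K : ℝ)
    obtain ⟨N, hN⟩ := ((Filter.eventually_gt_atTop 0).and ((h1.eventually_le_const hh₀).and
      (h2.eventually_le_const (half_pos hη)))).exists
    exact ⟨N, hN.1, hN.2.1, hN.2.2⟩
  have hNpos : (0 : ℝ) < N := Nat.cast_pos.2 hN0
  have hNh : N * (τ / N) = τ := by field_simp
  have hh : 0 < τ / N := by positivity
  generalize τ / (N : ℝ) = h at hN1 hN2 hNh hh
  -- Discrete Grönwall: each step turns an error `D` into at most `(1 + K * h) * D + η * h`, half of
  -- `η` for the network and half for Euler.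
  have key : ∀ k : ℕ, k ≤ N → ∃ F, NetApprox α F ∧ ∀ y, IsIntegralSolution u τ y → ‖y 0‖ ≤ r →
      ‖F (y 0) - y (k * h)‖ ≤ η * (k * h * Real.exp (K * (k * h))) := by
    intro k
    induction k with
    | zero => exact fun _ => ⟨_, netApprox_id, fun y _ _ => by simp⟩
    | succ k ih =>
      intro hk
      obtain ⟨F, hF, hFy⟩ := ih (by omega)
      have hkh : (k : ℝ) * h + h ≤ τ := by
        have : ((k + 1 : ℕ) : ℝ) ≤ N := Nat.cast_le.2 hk
        push_cast at this
        nlinarith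
      have hs : ((k + 1 : ℕ) : ℝ) * h = k * h + h := by push_cast; ring
      rw [hs]
      have ha : (0 : ℝ) ≤ k * h := by positivity
      generalize (k : ℝ) * h = a at hkh hFy ha
      have hL := norm_integral_sub_integral_le hu hu0 hmeas (a := a) (b := a + h)
      -- The time average of the field is again `K`-Lipschitz and zero at `0`, so continuity in time
      -- is not needed here.
      obtain ⟨G, hG, hGz⟩ := hstep h hh hN1 (fun z => h⁻¹ • ∫ s in a..(a + h), u z s)
        (LipschitzWith.of_dist_le_mul fun z w => by
          rw [dist_eq_norm, dist_eq_norm, ← smul_sub, norm_smul, norm_inv,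
            Real.norm_of_nonneg hh.le, inv_mul_le_iff₀ hh]
          have := hL z w (by linarith)
          linarith)
        (by simp [hu0])
      refine ⟨_, hG.comp hF, fun y hy hy0 => ?_⟩
      have e1 := hFy y hy hy0
      have hya := hyM y hy hy0
      have e2 : ‖F (y 0) - y a‖ ≤ 1 := by
        refine e1.trans ((mul_le_mul_of_nonneg_left ?_ hη.le).trans
          (hηE.trans_le (min_le_right _ _)))
        exact mul_le_mul (by linarith)
          (Real.exp_le_exp.2 (mul_le_mul_of_nonneg_left (by linarith) hK))
          (Real.exp_pos _).le hτ.le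
      have e3 := hGz (F (y 0)) (by
        have := norm_le_norm_add_norm_sub' (F (y 0)) (y a)
        linarith [hya a ha (by linarith)])
      rw [smul_inv_smul₀ hh.ne'] at e3
      have e4 := hL (F (y 0)) (y a) (by linarith)
      have e5 := hy.norm_euler_le hu hu0 hmeas ha (by linarith : a ≤ a + h) hkh
        (fun s h1 h2 => hya s (ha.trans h1) (h2.trans hkh))
      rw [add_sub_cancel_left] at e4 e5
      set D := ‖F (y 0) - y a‖ with hD
      have e6 : ‖G (F (y 0)) - y (a + h)‖ ≤ η / 2 * h + D + K * D * h + η / 2 * h := by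
        calc ‖G (F (y 0)) - y (a + h)‖
            = ‖(G (F (y 0)) - F (y 0) - ∫ s in a..(a + h), u (F (y 0)) s) + (F (y 0) - y a) +
                ((∫ s in a..(a + h), u (F (y 0)) s) - ∫ s in a..(a + h), u (y a) s) +
                -(y (a + h) - y a - ∫ s in a..(a + h), u (y a) s)‖ := by congr 1; abel
          _ ≤ η / 2 * h + D + K * D * h + η / 2 * h := by
              refine norm_add₄_le.trans ?_
              rw [norm_neg]
              have := mul_le_mul_of_nonneg_right hN2 hh.le
              linarith
      have e7 : 1 + K * h ≤ Real.exp (K * h) := by linarith [Real.add_one_le_exp (K * h)]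
      have e8 : Real.exp (K * (a + h)) = Real.exp (K * a) * Real.exp (K * h) := by
        rw [← Real.exp_add]; congr 1; ring
      have e9 : 1 ≤ Real.exp (K * (a + h)) := Real.one_le_exp (by positivity)
      have hKh : 0 ≤ 1 + K * h := by positivity
      calc ‖G (F (y 0)) - y (a + h)‖ ≤ (1 + K * h) * D + η * h := by linarith
        _ ≤ Real.exp (K * h) * (η * (a * Real.exp (K * a))) +
            η * h * Real.exp (K * (a + h)) := by
          refine add_le_add (mul_le_mul e7 e1 (norm_nonneg _) (Real.exp_pos _).le) ?_
          exact le_mul_of_one_le_right (by positivity) e9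
        _ = η * ((a + h) * Real.exp (K * (a + h))) := by rw [e8]; ring
  obtain ⟨F, hF, hFy⟩ := key N le_rfl
  refine ⟨F, hF, fun y hy hy0 => ?_⟩
  have := hFy y hy hy0
  rw [hNh, hηE] at this
  exact this.trans (min_le_left _ _)

end Discretization

/-! ### Reduction to a field vanishing at the origin. -/

section FlowMaps

variable {d : ℕ}

local notation "𝔼" => EuclideanSpace ℝ (Fin d)

/-- The field `v` in coordinates moving along the curve `c`, set to zero outside `G`. -/
noncomputable def movingField (v : 𝔼 → ℝ → 𝔼) (c : ℝ → 𝔼) (G : Set ℝ) (z : 𝔼) (t : ℝ) : 𝔼 :=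
  G.indicator (fun s => v (z + c s) s - v (c s) s) t

theorem movingField_zero (v : 𝔼 → ℝ → 𝔼) (c : ℝ → 𝔼) (G : Set ℝ) (t : ℝ) :
    movingField v c G 0 t = 0 := by
  simp [movingField]

theorem lipschitzWith_movingField {v : 𝔼 → ℝ → 𝔼} {c : ℝ → 𝔼} {G : Set ℝ} {K : NNReal}
    (hv : ∀ t ∈ G, LipschitzWith K (fun x => v x t)) (t : ℝ) :
    LipschitzWith K (fun z => movingField v c G z t) := by
  refine LipschitzWith.of_dist_le_mul fun z w => ?_
  by_cases ht : t ∈ G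
  · simpa [movingField, ht] using (hv t ht).dist_le_mul (z + c t) (w + c t)
  · simp only [movingField, Set.indicator_of_notMem ht, dist_self]
    positivity

theorem aestronglyMeasurable_movingField {v : 𝔼 → ℝ → 𝔼} {c y : ℝ → 𝔼} {G : Set ℝ}
    (hG : MeasurableSet G)
    (hv : ContinuousOn (fun p : 𝔼 × ℝ => v p.1 p.2) (Set.univ ×ˢ G)) (hc : ContinuousOn c G)
    (hy : ContinuousOn y G) :
    MeasureTheory.AEStronglyMeasurable (fun t => movingField v c G (y t) t)
      MeasureTheory.volume := by
  have key : ∀ x : ℝ → 𝔼, ContinuousOn x G → ContinuousOn (fun t => v (x t) t) G :=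
    fun x hx => hv.comp (hx.prodMk continuousOn_id) fun t ht => ⟨Set.mem_univ _, ht⟩
  have h : ContinuousOn (fun t => v (y t + c t) t - v (c t) t) G :=
    (key _ (hy.add hc)).sub (key _ hc)
  exact (aestronglyMeasurable_indicator_iff hG).2 (h.aestronglyMeasurable hG)

/-- Near break times `v (c t) t` may be unbounded, but the difference of velocities is at most `K *
‖γ t - c t‖`, hence integrable. The fundamental theorem of calculus tolerates the finitely many
exceptional times. -/
theorem isIntegralSolution_sub {v : 𝔼 → ℝ → 𝔼} {τ : ℝ} {K : NNReal} {S : Finset ℝ}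
    (hv : ∀ t ∈ Set.Ioo (0 : ℝ) τ \ (S : Set ℝ), LipschitzWith K (fun x => v x t))
    (hvc : ContinuousOn (fun p : 𝔼 × ℝ => v p.1 p.2)
      (Set.univ ×ˢ (Set.Ioo (0 : ℝ) τ \ (S : Set ℝ))))
    {x₀ x₁ : 𝔼} {c γ : ℝ → 𝔼} (hc : IsSolution v τ x₀ c) (hγ : IsSolution v τ x₁ γ) :
    IsIntegralSolution (movingField v c (Set.Ioo (0 : ℝ) τ \ (S : Set ℝ))) τ
      (fun t => γ t - c t) := by
  obtain ⟨hcc, -, S₀, hS₀⟩ := hc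
  obtain ⟨hγc, -, S₁, hS₁⟩ := hγ
  set G := Set.Ioo (0 : ℝ) τ \ (S : Set ℝ) with hG
  have hGI : G ⊆ Set.Icc 0 τ := Set.sdiff_subset.trans Set.Ioo_subset_Icc_self
  have hGm : MeasurableSet G := measurableSet_Ioo.diff S.measurableSet
  have hyc : ContinuousOn (fun t => γ t - c t) (Set.Icc 0 τ) := hγc.sub hcc
  refine ⟨hyc, fun a b ha hab hb => ?_⟩
  have hint : IntervalIntegrable (fun s => movingField v c G (γ s - c s) s)
      MeasureTheory.volume a b := by
    obtain ⟨M, hM⟩ := isCompact_Icc.exists_bound_of_continuousOn hyc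
    refine (intervalIntegrable_const (c := K * M)).mono_fun
      (aestronglyMeasurable_movingField hGm hvc (hcc.mono hGI) (hyc.mono hGI)).restrict ?_
    refine MeasureTheory.ae_restrict_of_forall_mem measurableSet_uIoc fun s hs => ?_
    rw [Set.uIoc_of_le hab] at hs
    refine (norm_le_mul_norm_of_lipschitz (lipschitzWith_movingField hv s)
      (movingField_zero v c G s) _).trans ((mul_le_mul_of_nonneg_left
        (hM s ⟨ha.trans hs.1.le, hs.2.trans hb⟩) K.2).trans (le_abs_self _))
  refine ⟨hint, Eq.symm ?_⟩
  refine MeasureTheory.integral_eq_of_hasDerivAt_off_countable_of_le _ _ hab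
    (s := (S ∪ S₀ ∪ S₁ : Finset ℝ)) (Finset.countable_toSet _)
    (hyc.mono (Set.Icc_subset_Icc ha hb)) (fun t ht => ?_) hint
  obtain ⟨htI, htS⟩ := ht
  simp only [Finset.coe_union, Set.mem_union, Finset.mem_coe, not_or] at htS
  have ht : t ∈ Set.Ioo 0 τ := ⟨ha.trans_lt htI.1, htI.2.trans_le hb⟩
  have htG : t ∈ G := ⟨ht, htS.1.1⟩
  have h := (hS₁ t ht htS.2).sub (hS₀ t ht htS.1.2)
  have he : movingField v c G (γ t - c t) t = v (γ t) t - v (c t) t := by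
    simp [movingField, htG]
  rw [he]
  exact h

end FlowMaps

theorem theorem1 (d : ℕ) (α : ℝ) (hα : α ∈ Set.Ioo (0 : ℝ) 1)
    (Ω : Set (EuclideanSpace ℝ (Fin d))) (hΩ : IsCompact Ω)
    (ε : ℝ) (hε : 0 < ε) (τ : ℝ) (hτ : 0 < τ)
    (v : EuclideanSpace ℝ (Fin d) → ℝ → EuclideanSpace ℝ (Fin d))
    (hv : IsLipschitzPiecewiseField τ v)
    (φ : EuclideanSpace ℝ (Fin d) → EuclideanSpace ℝ (Fin d))
    (hφ : IsFlowMap v τ φ) :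
    ∃ (L : ℕ) (f : EuclideanSpace ℝ (Fin d) → EuclideanSpace ℝ (Fin d)),
      f ∈ LeakyReLUNetworks α d L ∧ ∀ x ∈ Ω, ‖f x - φ x‖ ≤ ε := by
  obtain ⟨S, ⟨K, hK⟩, hvc⟩ := hv
  obtain ⟨c, hc, -⟩ := hφ 0
  obtain ⟨r, hr⟩ := hΩ.isBounded.exists_norm_le
  have hGI : Set.Ioo (0 : ℝ) τ \ (S : Set ℝ) ⊆ Set.Icc 0 τ :=
    Set.sdiff_subset.trans Set.Ioo_subset_Icc_self
  obtain ⟨F, hF, hFy⟩ := exists_netApprox_solution_map hα hτ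
    (lipschitzWith_movingField (c := c) hK) (movingField_zero v c _)
    (fun z => aestronglyMeasurable_movingField (y := fun _ => z)
      (measurableSet_Ioo.diff S.measurableSet) hvc (hc.1.mono hGI) continuousOn_const)
    (le_max_right r 0) (half_pos hε)
  obtain ⟨f, hf, hfF⟩ := hF.2 (max r 0) (ε / 2) (half_pos hε)
  -- `F` approximates the flow relative to the trajectory `c` from `0`; translating by `c τ`
  -- restores the original coordinates.
  obtain ⟨L, hL⟩ := (isNet_affine LinearMap.id (c τ)).comp hf
  refine ⟨L, _, hL, fun x hx => ?_⟩
  have hxr : ‖x‖ ≤ max r 0 := (hr x hx).trans (le_max_left _ _)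
  obtain ⟨γ, hγ, hγφ⟩ := hφ x
  have hx0 : γ 0 - c 0 = x := by rw [hγ.2.1, hc.2.1, sub_zero]
  have h1 := hFy _ (isIntegralSolution_sub hK hvc hc hγ) (by simpa only [hx0] using hxr)
  simp only [hx0, hγφ] at h1
  calc ‖LinearMap.id (R := ℝ) (f x) + c τ - φ x‖
      = ‖(f x - F x) + (F x - (φ x - c τ))‖ := by
        rw [LinearMap.id_apply]; congr 1; abel
    _ ≤ ‖f x - F x‖ + ‖F x - (φ x - c τ)‖ := norm_add_le _ _
    _ ≤ ε := by linarith [hfF x hxr]
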